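/- Let $\nu$ be the morphism on words over $\{0,1,2\}$ with $\nu(0)=01$, $\nu(1)=2$, $\nu(2)=0$, and let $\mathbf{n} = n_0 n_1 n_2\cdots = 0120010120120\cdots$ be its infinite fixed point starting with $0$. Let $N_i = |\nu^i(0)|$ for $i\ge 0$ (so $N_0,N_1,N_2,\ldots = 1,2,3,4,6,9,13,\ldots$), and for a binary string $e_1e_2\cdots e_t$ put $[e_1e_2\cdots e_t]_N = \sum_{1\le i\le t} e_i N_{t-i}$. Number the positions of $\mathbf{n}$ from $1$, so that the letter at position $k\ge 1$ is $n_{k-1}$. For $i\in\{0,1,2\}$ and $j\ge 1$ let $p_i(j)$ be the position of the $j$-th occurrence of the letter $i$, and let $p_{02}(j)$ be the position of the $j$-th occurrence of a letter in $\{0,2\}$. Let $P_i=\{p_i(j) : j\ge 1\}$ for $i\in\{0,1,2\}$ and $P_{02}=\{p_{02}(j) : j\ge 1\}$. For sets $S,T$ of natural numbers let $S+T=\{s+t : s\in S,\ t\in T\}$. Then: (i) For all $n\ge 4$ we have $n\in P_{02}+P_{02}$. (ii) For all $n\ge 17$ we have $n\in P_0+P_0$. (iii) For all $n$ of the form $[(100)^i100000]_N$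 with $i\ge 0$ we have $n\notin P_1+P_1$. (iv) For all $n\ge 27$ we have $n\in P_1+P_1+P_1$. (v) For all $n$ of the form $[1(00)^i1]_N$ with $i\ge 1$ we have $n\notin P_2+P_2$. (vi) For all $n\ge 140$ we have $n\in P_2+P_2+P_2$. -/

import Mathlib

open scoped Pointwise

namespace Narayana

/-- The Narayana morphism on letters: `0 ↦ 01`, `1 ↦ 2`, `2 ↦ 0`. -/
def letterImage : Fin 3 → List (Fin 3)
  | 0 => [0, 1]
  | 1 => [2]
  | 2 => [0]

/-- The Narayana morphism `ν` on finite words. -/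
def morphism (w : List (Fin 3)) : List (Fin 3) := w.flatMap letterImage

/-- The finite word `ν^i(0)`. -/
def iter (i : ℕ) : List (Fin 3) := morphism^[i] [0]

theorem iter_succ (i : ℕ) : iter (i + 1) = morphism (iter i) := by
  simp only [iter, Function.iterate_succ_apply']

theorem length_le_length_morphism (w : List (Fin 3)) : w.length ≤ (morphism w).length := by
  induction w with
  | nil => simp
  | cons a w ih =>
    have h : 1 ≤ (letterImage a).length := by fin_cases a <;> simp [letterImage]
    simp only [morphism, List.flatMap_cons, List.length_append, List.length_cons] at ih ⊢
    omega

theorem iter_eq_cons (i : ℕ) : ∃ t, iter i = 0 :: t := by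
  induction i with
  | zero => exact ⟨[], rfl⟩
  | succ i ih =>
    obtain ⟨t, ht⟩ := ih
    exact ⟨1 :: morphism t, by rw [iter_succ, ht]; simp [morphism, letterImage]⟩

/-- The word `ν^i(0)` is long enough to have a letter with (zero-based) index `i`. -/
theorem lt_length_iter (i : ℕ) : i < (iter i).length := by
  induction i with
  | zero => simp [iter]
  | succ i ih =>
    obtain ⟨t, ht⟩ := iter_eq_cons i
    have h := length_le_length_morphism t
    rw [iter_succ, ht]
    rw [ht] at ih
    simp only [morphism, List.flatMap_cons, List.length_append, List.length_cons,
      letterImage, List.length_nil] at ih h ⊢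
    omega

/-- Each `ν^i(0)` is a prefix of the next one, so that these words converge. -/
theorem iter_prefix_succ (i : ℕ) : iter i <+: iter (i + 1) := by
  induction i with
  | zero => exact ⟨[1], rfl⟩
  | succ i ih =>
    obtain ⟨t, ht⟩ := ih
    refine ⟨morphism t, ?_⟩
    conv_rhs => rw [iter_succ (i + 1), ← ht]
    rw [iter_succ]
    simp [morphism]

/-- The infinite Narayana word `n₀ n₁ n₂ ⋯ = 0120010120120⋯`, the fixed point of `ν` that starts
with `0`, i.e. the limit of the words `ν^i(0)`: its letter with index `k` is read off from
`ν^k(0)`, which is a prefix of it of length greater than `k`. -/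
def word (k : ℕ) : Fin 3 := (iter k)[k]'(lt_length_iter k)

/-- The Narayana numbers `N_i = |ν^i(0)|`: `1, 2, 3, 4, 6, 9, 13, 19, 28, …`. -/
def num (i : ℕ) : ℕ := (iter i).length

/-- The value `[e₁ e₂ ⋯ e_t]_N = ∑_{1 ≤ i ≤ t} e_i N_{t-i}` of a string of digits, with the most
significant digit first. -/
def value : List ℕ → ℕ
  | [] => 0
  | e :: es => e * num es.length + value es

/-- `occ S k`: in the Narayana word, indexed from position `1` (so that the letter at position
`k ≥ 1` is `n_{k-1}`), the letter at position `k` lies in `S`. -/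
def occ (S : Set (Fin 3)) (k : ℕ) : Prop := 1 ≤ k ∧ word (k - 1) ∈ S

/-- For `j ≥ 1`, the position of the `j`-th occurrence of a letter of `S` in the Narayana word,
where positions and occurrences are both counted from `1` (`Nat.nth` counts from `0`). -/
noncomputable def pos (S : Set (Fin 3)) (j : ℕ) : ℕ := Nat.nth (occ S) (j - 1)

/-- `P₀₂ = {p₀₂(j) : j ≥ 1}`. -/
def P02 : Set ℕ := {m | ∃ j, 1 ≤ j ∧ pos {0, 2} j = m}

/-- `P₀ = {p₀(j) : j ≥ 1}`. -/
def P0 : Set ℕ := {m | ∃ j, 1 ≤ j ∧ pos {0} j = m}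

/-- `P₁ = {p₁(j) : j ≥ 1}`. -/
def P1 : Set ℕ := {m | ∃ j, 1 ≤ j ∧ pos {1} j = m}

/-- `P₂ = {p₂(j) : j ≥ 1}`. -/
def P2 : Set ℕ := {m | ∃ j, 1 ≤ j ∧ pos {2} j = m}

end Narayana

namespace Narayana

/-! Indices start at 0 here. Appending the digit 0 to the representation of `n` gives `shift n`,
where the image of the `n`-th letter begins; appending 1 gives `shift n + 1`, which is possible only
if that letter is 0. Iterates of `shift` cut the word into blocks ν^j(a).

The positive statements come from these blocks. All ν^3(a) begin with 01 and all ν^4(a) with 012, so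
the letters 1 and 2 recur at every block start plus a constant; adding a short run of consecutive
twofold sums fills every gap (`exists_shift_iterate_add`). For the letter 0, only five factors of
length two occur, and a finite check on ν^10 of these covers everything (`exists_zero_add_zero`).
For {0,2}, the block starts `shift a` suffice.

The negative statements come from a finite automaton. By `shift_shift_shift` the defect x + y - n,
taken at three consecutive scales, evolves linearly as digits are appended. Only small defects
matter, since a large one never becomes small again (`Covers.transfer`). The reachable states form
finite sets closed under the digit patterns, and none of the final ones has the forbidden defect and
letters. -/

/-! ### Prefixes and factors of the word -/

theorem iter_prefix_add (i k : ℕ) : iter i <+: iter (i + k) := by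
  induction k with
  | zero => exact List.prefix_rfl
  | succ k ih => exact ih.trans (iter_prefix_succ (i + k))

theorem getElem?_iter_add {i k : ℕ} (h : k < (iter i).length) (j : ℕ) :
    (iter (i + j))[k]? = (iter i)[k]? := by
  obtain ⟨t, ht⟩ := iter_prefix_add i j
  rw [← ht, List.getElem?_append_left h]

/-- Every `ν^i(0)` is a prefix of the Narayana word. -/
theorem getElem?_iter {i k : ℕ} (h : k < (iter i).length) : (iter i)[k]? = some (word k) := by
  have hk : (iter k)[k]? = some (word k) := by
    rw [word]; exact List.getElem?_eq_getElem (lt_length_iter k)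
  rcases le_total i k with hik | hik
  · obtain ⟨j, rfl⟩ := Nat.exists_eq_add_of_le hik
    rw [← hk, getElem?_iter_add h]
  · obtain ⟨j, rfl⟩ := Nat.exists_eq_add_of_le hik
    rw [← hk, getElem?_iter_add (lt_length_iter k)]

/-- The finite word `u` occurs in the Narayana word at index `p`. -/
def OccursAt : List (Fin 3) → ℕ → Prop
  | [], _ => True
  | a :: u, p => word p = a ∧ OccursAt u (p + 1)

theorem occursAt_iff (u : List (Fin 3)) (p : ℕ) :
    OccursAt u p ↔ ∀ r < u.length, u[r]? = some (word (p + r)) := by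
  induction u generalizing p with
  | nil => simp [OccursAt]
  | cons a u ih =>
    rw [OccursAt, ih]
    constructor
    · rintro ⟨h0, h⟩ (_ | r) hr
      · simp [h0]
      · rw [List.getElem?_cons_succ, h r (by simpa using hr)]
        congr 2; omega
    · intro h
      refine ⟨by simpa using (h 0 (by simp)).symm, fun r hr => ?_⟩
      have := h (r + 1) (by simpa using hr)
      rw [List.getElem?_cons_succ] at this
      rw [this]; congr 2; omega

theorem occursAt_append (u v : List (Fin 3)) (p : ℕ) :
    OccursAt (u ++ v) p ↔ OccursAt u p ∧ OccursAt v (p + u.length) := by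
  induction u generalizing p with
  | nil => simp [OccursAt]
  | cons a u ih =>
    simp only [List.cons_append, OccursAt, ih, and_assoc, List.length_cons]
    rw [show p + 1 + u.length = p + (u.length + 1) by omega]

theorem occursAt_iter (i : ℕ) : OccursAt (iter i) 0 := by
  rw [occursAt_iff]
  intro r hr
  rw [getElem?_iter hr, Nat.zero_add]

/-! ### The index map `shift` and appending digits -/

/-- The length of the image under `ν` of the prefix of length `n` of the Narayana word. -/
def shift : ℕ → ℕ
  | 0 => 0
  | n + 1 => shift n + (letterImage (word n)).length

theorem length_letterImage_pos (a : Fin 3) : 1 ≤ (letterImage a).length := by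
  fin_cases a <;> simp [letterImage]

theorem length_morphism {u : List (Fin 3)} {p : ℕ} (h : OccursAt u p) :
    shift p + (morphism u).length = shift (p + u.length) := by
  induction u generalizing p with
  | nil => simp [morphism]
  | cons a u ih =>
    have := ih h.2
    rw [shift, h.1] at this
    simp only [morphism, List.flatMap_cons, List.length_append, List.length_cons] at this ⊢
    rw [show p + (u.length + 1) = p + 1 + u.length by omega, ← this]
    omega

/-- Cut ν^n(0) around its letter of index `n` and apply ν: the result is again a prefix of the word,
and the part before the cut has image of length `shift n`. -/
theorem occursAt_letterImage (n : ℕ) : OccursAt (letterImage (word n)) (shift n) := by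
  have hi := occursAt_iter n
  have hi' := occursAt_iter (n + 1)
  have hn := lt_length_iter n
  have hsplit : iter n = (iter n).take n ++ word n :: (iter n).drop (n + 1) := by
    have : (iter n)[n] = word n := rfl
    rw [← this, List.cons_getElem_drop_succ, List.take_append_drop]
  rw [hsplit, occursAt_append] at hi
  have hl := length_morphism hi.1
  rw [iter_succ, hsplit] at hi'
  simp only [morphism, List.flatMap_append, List.flatMap_cons] at hi' hl
  rw [occursAt_append, occursAt_append] at hi'
  have := hi'.2.1
  simp only [List.length_take, Nat.min_eq_left hn.le, shift, Nat.zero_add] at hl this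
  rwa [hl] at this

/-- The Narayana word is a fixed point of `ν`. -/
theorem OccursAt.morphism {u : List (Fin 3)} {p : ℕ} (h : OccursAt u p) :
    OccursAt (morphism u) (shift p) := by
  induction u generalizing p with
  | nil => trivial
  | cons a u ih =>
    have h1 := occursAt_letterImage p
    have h2 := ih h.2
    rw [h.1] at h1
    rw [shift, h.1] at h2
    rw [Narayana.morphism, List.flatMap_cons, occursAt_append]
    exact ⟨h1, h2⟩

theorem OccursAt.morphism_iterate {u : List (Fin 3)} {p : ℕ} (h : OccursAt u p) (j : ℕ) :
    OccursAt (Narayana.morphism^[j] u) (shift^[j] p) ∧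
      shift^[j] p + (Narayana.morphism^[j] u).length = shift^[j] (p + u.length) := by
  induction j with
  | zero => exact ⟨h, rfl⟩
  | succ j ih =>
    simp only [Function.iterate_succ_apply']
    exact ⟨ih.1.morphism, by rw [length_morphism ih.1, ih.2]⟩

theorem shift_strictMono : StrictMono shift :=
  strictMono_nat_of_lt_succ fun n => by
    have := length_letterImage_pos (word n)
    rw [shift]; omega

theorem shift_iterate_strictMono (j : ℕ) : StrictMono shift^[j] := shift_strictMono.iterate j

theorem shift_iterate_zero (j : ℕ) : shift^[j] 0 = 0 := Function.iterate_fixed rfl j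

/-- Every index lies in the image of exactly one letter under `ν^j`. -/
theorem exists_shift_iterate_le (j m : ℕ) :
    ∃ k, shift^[j] k ≤ m ∧ m < shift^[j] (k + 1) := by
  have hex : ∃ k, m < shift^[j] (k + 1) :=
    ⟨m, Nat.lt_of_lt_of_le (Nat.lt_succ_self m) (shift_iterate_strictMono j).le_apply⟩
  classical
  refine ⟨Nat.find hex, ?_, Nat.find_spec hex⟩
  rcases h : Nat.find hex with _ | k
  · rw [shift_iterate_zero]; exact Nat.zero_le m
  · exact not_lt.1 (Nat.find_min hex (h ▸ Nat.lt_succ_self k))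

theorem fin3_cases (a : Fin 3) : a = 0 ∨ a = 1 ∨ a = 2 := by
  fin_cases a <;> simp

/-- Letter by letter, |ν^3(a)| = |ν^2(a)| + 1. -/
theorem shift_shift_shift (n : ℕ) : shift (shift (shift n)) = shift (shift n) + n := by
  induction n with
  | zero => rfl
  | succ n ih =>
    have h : OccursAt [word n] n := ⟨rfl, trivial⟩
    have h2 := (h.morphism_iterate 2).2
    have h3 := (h.morphism_iterate 3).2
    simp only [Function.iterate_succ, Function.iterate_zero, Function.comp_apply, id,
      List.length_singleton] at h2 h3
    rw [← h3, ih, ← h2]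
    rcases fin3_cases (word n) with h | h | h <;> simp [h, morphism, letterImage] <;> omega

/-- The pairs `(e, b)` such that an index of a letter `a` with the digit `e` appended to its
representation is an index of the letter `b`. -/
def successors : Fin 3 → List (ℕ × Fin 3)
  | 0 => [(0, 0), (1, 1)]
  | 1 => [(0, 2)]
  | 2 => [(0, 0)]

theorem word_shift (n : ℕ) : (0, word (shift n)) ∈ successors (word n) := by
  have h := occursAt_letterImage n
  rcases fin3_cases (word n) with h0 | h0 | h0 <;> rw [h0] at h ⊢ <;> rw [h.1] <;> simp [successors]

theorem word_shift_add_one {n : ℕ} (hn : word n = 0) : word (shift n + 1) = 1 := by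
  have h := occursAt_letterImage n
  rw [hn] at h
  exact h.2.1

theorem shift_succ_of_zero {n : ℕ} (hn : word n = 0) : shift (n + 1) = shift n + 2 := by
  rw [shift, hn]; rfl

theorem word_shift_of_zero {n : ℕ} (hn : word n = 0) : word (shift n) = 0 := by
  simpa [hn, successors] using word_shift n

theorem shift_shift_add_one {n : ℕ} (hn : word n = 0) :
    shift (shift n + 1) = shift (shift n) + 2 :=
  shift_succ_of_zero (word_shift_of_zero hn)

theorem shift_shift_shift_add_one {n : ℕ} (hn : word n = 0) :
    shift (shift (shift n + 1)) = shift (shift n) + n + 3 := by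
  rw [shift_shift_add_one hn, ← shift_shift_shift]
  have h0 := word_shift_of_zero (word_shift_of_zero hn)
  have h1 : word (shift (shift n) + 1) = 1 := word_shift_add_one (word_shift_of_zero hn)
  rw [shift, h1, shift_succ_of_zero h0]
  rfl

/-- Strips the last digit `e`. The factors 2 and 3 are N_1 and N_2, the weights of `e` after one and
two further zeros. -/
theorem exists_eq_shift_add (m : ℕ) : ∃ n e, m = shift n + e ∧ (e, word m) ∈ successors (word n) ∧
    shift m = shift (shift n) + 2 * e ∧ shift (shift m) = shift (shift n) + n + 3 * e ∧
    shift n + e < shift (n + 1) := by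
  obtain ⟨n, h1, h2⟩ := exists_shift_iterate_le 1 m
  simp only [Function.iterate_one] at h1 h2
  obtain ⟨e, rfl⟩ := Nat.exists_eq_add_of_le h1
  have key : ∀ n, (0, word (shift n + 0)) ∈ successors (word n) ∧
      shift (shift n + 0) = shift (shift n) + 2 * 0 ∧
      shift (shift (shift n + 0)) = shift (shift n) + n + 3 * 0 := fun n =>
    ⟨word_shift n, rfl, shift_shift_shift n⟩
  refine ⟨n, e, rfl, ?_⟩
  have h3 := h2
  rw [shift] at h3
  rcases fin3_cases (word n) with h | h | h <;> simp only [h, letterImage, List.length_cons,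
    List.length_nil] at h3
  · obtain rfl | rfl : e = 0 ∨ e = 1 := by omega
    · exact ⟨(key n).1, (key n).2.1, (key n).2.2, h2⟩
    · refine ⟨?_, shift_shift_add_one h, shift_shift_shift_add_one h, h2⟩
      rw [word_shift_add_one h, h]; simp [successors]
  · obtain rfl : e = 0 := by omega
    exact ⟨(key n).1, (key n).2.1, (key n).2.2, h2⟩
  · obtain rfl : e = 0 := by omega
    exact ⟨(key n).1, (key n).2.1, (key n).2.2, h2⟩

theorem word_zero : word 0 = 0 := rfl

theorem num_eq_iterate (i : ℕ) : num i = shift^[i] 1 := by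
  have h : OccursAt [0] 0 := ⟨word_zero, trivial⟩
  have := (h.morphism_iterate i).2
  rwa [shift_iterate_zero, Nat.zero_add] at this

theorem num_add_three (i : ℕ) : num (i + 3) = num (i + 2) + num i := by
  simp only [num_eq_iterate, Function.iterate_succ_apply', shift_shift_shift]

/-! ### From occurrence counts to letters at indices -/

/-- Positions of letters: the `j`-th occurrences range over all the occurrences. -/
theorem exists_pos_iff {S : Set (Fin 3)} (hS : {k | occ S k}.Infinite) (m : ℕ) :
    (∃ j, 1 ≤ j ∧ pos S j = m) ↔ occ S m := by
  have hr := Nat.range_nth_of_infinite hS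
  constructor
  · rintro ⟨j, -, rfl⟩
    exact Nat.nth_mem_of_infinite hS _
  · intro h
    obtain ⟨j, hj⟩ := hr.symm.subset h
    exact ⟨j + 1, by omega, by simpa [pos] using hj⟩

/-- Appending the digits 100 at a letter 0 runs through the letters 1, 2, 0 and increases the index.
-/
theorem infinite_word_zero (N : ℕ) : ∃ n, N ≤ n ∧ word n = 0 := by
  have h0 : ∀ j, word (shift^[j] 0) = 0 := fun j => by rw [shift_iterate_zero]; rfl
  have h : ∀ j, ∃ n, j ≤ n ∧ word n = 0 := by
    intro j
    induction j with
    | zero => exact ⟨0, le_rfl, rfl⟩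
    | succ j ih =>
      obtain ⟨n, hn, hw⟩ := ih
      have h1 : word (shift n + 1) = 1 := word_shift_add_one hw
      have h2 : word (shift (shift n + 1)) = 2 := by
        simpa [h1, successors] using word_shift (shift n + 1)
      refine ⟨shift (shift (shift n + 1)), ?_, by
        simpa [h2, successors] using word_shift (shift (shift n + 1))⟩
      rw [shift_shift_shift_add_one hw]
      omega
  exact h N

theorem infinite_occ {S : Set (Fin 3)} {a : Fin 3} (ha : a ∈ S) : {k | occ S k}.Infinite := by
  refine Set.infinite_of_not_bddAbove ?_
  rintro ⟨B, hB⟩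
  suffices ∃ n, B ≤ n ∧ word n = a by
    obtain ⟨n, hn, hw⟩ := this
    have : n + 1 ≤ B := hB (show occ S (n + 1) from ⟨by omega, by simpa [hw] using ha⟩)
    omega
  obtain ⟨n, hn, hw⟩ := infinite_word_zero B
  have hle : ∀ m, m ≤ shift m := fun m => shift_strictMono.le_apply
  have h1 : word (shift n + 1) = 1 := word_shift_add_one hw
  rcases fin3_cases a with rfl | rfl | rfl
  · exact ⟨n, hn, hw⟩
  · exact ⟨shift n + 1, by have := hle n; omega, h1⟩
  · exact ⟨shift (shift n + 1), by have := hle n; have := hle (shift n + 1); omega,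
      by simpa [h1, successors] using word_shift (shift n + 1)⟩

theorem mem_P02 (m : ℕ) : m ∈ P02 ↔ 1 ≤ m ∧ (word (m - 1) = 0 ∨ word (m - 1) = 2) :=
  exists_pos_iff (infinite_occ (a := 0) (by simp)) m

theorem mem_P0 (m : ℕ) : m ∈ P0 ↔ 1 ≤ m ∧ word (m - 1) = 0 :=
  exists_pos_iff (infinite_occ (a := 0) (by simp)) m

theorem mem_P1 (m : ℕ) : m ∈ P1 ↔ 1 ≤ m ∧ word (m - 1) = 1 :=
  exists_pos_iff (infinite_occ (a := 1) (by simp)) m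

theorem mem_P2 (m : ℕ) : m ∈ P2 ↔ 1 ≤ m ∧ word (m - 1) = 2 :=
  exists_pos_iff (infinite_occ (a := 2) (by simp)) m

/-! ### Threefold sums of the letters 1 and 2 -/

/-- If no two consecutive blocks `ν^j(a)` are longer than `g` and `s, …, s + g - 1` all lie in
`Q`, then every `n ≥ s` is the sum of a block start and an element of `Q`. -/
theorem exists_shift_iterate_add {j g s n : ℕ} {Q : ℕ → Prop}
    (hg : ∀ k, shift^[j] (k + 1) ≤ shift^[j] k + g) (hQ : ∀ r < g, Q (s + r)) (hn : s ≤ n) :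
    ∃ k q, Q q ∧ n = shift^[j] k + q := by
  obtain ⟨k, h1, h2⟩ := exists_shift_iterate_le j (n - s)
  have := hg k
  exact ⟨k, s + (n - s - shift^[j] k), hQ _ (by omega), by omega⟩

theorem shift_iterate_succ_le (j : ℕ) {g : ℕ}
    (hg : ∀ a, (morphism^[j] [a]).length ≤ g) (k : ℕ) : shift^[j] (k + 1) ≤ shift^[j] k + g := by
  have h : OccursAt [word k] k := ⟨rfl, trivial⟩
  have := (h.morphism_iterate j).2
  simp only [List.length_singleton] at this
  have := hg (word k)
  omega

theorem word_shift_three (k : ℕ) : word (shift^[3] k + 1) = 1 := by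
  have h : OccursAt [word k] k := ⟨rfl, trivial⟩
  have := (h.morphism_iterate 3).1
  rcases fin3_cases (word k) with h | h | h <;> rw [h] at this <;> exact this.2.1

theorem word_shift_four (k : ℕ) : word (shift^[4] k + 2) = 2 := by
  have h : OccursAt [word k] k := ⟨rfl, trivial⟩
  have := (h.morphism_iterate 4).1
  rcases fin3_cases (word k) with h | h | h <;> rw [h] at this <;> exact this.2.2.1

/-- The letter `a` has index `k` in the prefix `ν^14(0)` of the Narayana word. -/
def early (a : Fin 3) (k : ℕ) : Bool := (iter 14)[k]? == some a

theorem word_of_early {a : Fin 3} {k : ℕ} (h : early a k) : word k = a := by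
  have h : (iter 14)[k]? = some a := by simpa [early] using h
  have hk : k < (iter 14).length := by
    by_contra hk
    rw [List.getElem?_eq_none (not_lt.1 hk)] at h
    cases h
  rw [getElem?_iter hk] at h
  exact Option.some.inj h

theorem P1_triple {n : ℕ} (hn : 27 ≤ n) : n ∈ P1 + P1 + P1 := by
  have add : ∀ a b c, word a = 1 → word b = 1 → word c = 1 →
      a + b + c + 3 ∈ P1 + P1 + P1 := fun a b c ha hb hc => by
    refine ⟨_, ⟨a + 1, (mem_P1 _).2 ⟨by omega, ha⟩, b + 1, (mem_P1 _).2 ⟨by omega, hb⟩, rfl⟩,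
      c + 1, (mem_P1 _).2 ⟨by omega, hc⟩, ?_⟩
    simp only; omega
  rcases le_or_gt 46 n with h | h
  -- Blocks ν^3(a) have length at most 4, and 42, …, 45 are sums of two indices of 1. The offset 4
  -- is 1 for the place of the letter in its block plus 3 for passing from indices to positions.
  · obtain ⟨k, q, ⟨b, c, hb, hc, rfl⟩, hk⟩ := exists_shift_iterate_add (j := 3) (g := 4) (s := 42)
      (n := n - 4) (Q := fun q => ∃ b c, word b = 1 ∧ word c = 1 ∧ q = b + c)
      (shift_iterate_succ_le 3 (by decide)) (fun r hr => by
        have : ∀ r < 4, ∃ b < 50, early 1 b ∧ b ≤ 42 + r ∧ early 1 (42 + r - b) := by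
          decide +kernel
        obtain ⟨b, -, hb, hbr, hc⟩ := this r hr
        exact ⟨b, _, word_of_early hb, word_of_early hc, by omega⟩) (by omega)
    have := add _ b c (word_shift_three k) hb hc
    rwa [show shift^[3] k + 1 + b + c + 3 = n by omega] at this
  · have : ∀ r < 19, ∃ a < 50, early 1 a ∧ ∃ b < 50, early 1 b ∧ a + b ≤ 24 + r ∧
        early 1 (24 + r - a - b) := by
      decide +kernel
    obtain ⟨a, -, ha, b, -, hb, hab, hc⟩ := this (n - 27) (by omega)
    have := add a b _ (word_of_early ha) (word_of_early hb) (word_of_early hc)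
    rwa [show a + b + (24 + (n - 27) - a - b) + 3 = n by omega] at this

theorem P2_triple {n : ℕ} (hn : 140 ≤ n) : n ∈ P2 + P2 + P2 := by
  have add : ∀ a b c, word a = 2 → word b = 2 → word c = 2 →
      a + b + c + 3 ∈ P2 + P2 + P2 := fun a b c ha hb hc => by
    refine ⟨_, ⟨a + 1, (mem_P2 _).2 ⟨by omega, ha⟩, b + 1, (mem_P2 _).2 ⟨by omega, hb⟩, rfl⟩,
      c + 1, (mem_P2 _).2 ⟨by omega, hc⟩, ?_⟩
    simp only; omega
  rcases le_or_gt 159 n with h | h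
  -- Likewise with ν^4: blocks of length at most 6, the run 154, …, 159, and the offset 5 = 2 + 3.
  · obtain ⟨k, q, ⟨b, c, hb, hc, rfl⟩, hk⟩ := exists_shift_iterate_add (j := 4) (g := 6) (s := 154)
      (n := n - 5) (Q := fun q => ∃ b c, word b = 2 ∧ word c = 2 ∧ q = b + c)
      (shift_iterate_succ_le 4 (by decide)) (fun r hr => by
        have : ∀ r < 6, ∃ b < 160, early 2 b ∧ b ≤ 154 + r ∧ early 2 (154 + r - b) := by
          decide +kernel
        obtain ⟨b, -, hb, hbr, hc⟩ := this r hr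
        exact ⟨b, _, word_of_early hb, word_of_early hc, by omega⟩) (by omega)
    have := add _ b c (word_shift_four k) hb hc
    rwa [show shift^[4] k + 2 + b + c + 3 = n by omega] at this
  · have : ∀ r < 19, ∃ a < 80, early 2 a ∧ ∃ b < 160, early 2 b ∧ a + b ≤ 137 + r ∧
        early 2 (137 + r - a - b) := by
      decide +kernel
    obtain ⟨a, -, ha, b, -, hb, hab, hc⟩ := this (n - 140) (by omega)
    have := add a b _ (word_of_early ha) (word_of_early hb) (word_of_early hc)
    rwa [show a + b + (137 + (n - 140) - a - b) + 3 = n by omega] at this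

/-! ### Twofold sums of the letter 0 -/

/-- The factors of length two of the Narayana word. -/
def pairs : List (Fin 3 × Fin 3) := [(0, 0), (0, 1), (1, 0), (1, 2), (2, 0)]

theorem OccursAt.word_eq {u : List (Fin 3)} {p r : ℕ} {a : Fin 3} (h : OccursAt u p)
    (hr : u[r]? = some a) : word (p + r) = a := by
  have hl : r < u.length := (List.getElem?_eq_some_iff.1 hr).1
  rw [(occursAt_iff u p).1 h r hl] at hr
  exact Option.some.inj hr

/-- For `p > 0` the pair at `p` lies inside ν of the pair at some `k < p`, and `pairs` is closed
under taking such factors. -/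
theorem pair_mem (p : ℕ) : (word p, word (p + 1)) ∈ pairs := by
  induction p using Nat.strong_induction_on with
  | _ p ih =>
    rcases Nat.eq_zero_or_pos p with rfl | hp
    · decide +kernel
    obtain ⟨k, h1, h2⟩ := exists_shift_iterate_le 1 p
    simp only [Function.iterate_one] at h1 h2
    obtain ⟨e, rfl⟩ := Nat.exists_eq_add_of_le h1
    have hk : k < shift k + e := by
      rcases Nat.eq_zero_or_pos k with rfl | hk
      · exact hp
      · have := shift_strictMono.add_le_nat (k - 1) 1
        rw [Nat.sub_add_cancel hk] at this
        have h1 : shift 1 = 2 := rfl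
        omega
    have hab := ih k hk
    have hocc : OccursAt [word k, word (k + 1)] k := ⟨rfl, rfl, trivial⟩
    have hocc := hocc.morphism
    rw [shift] at h2
    have he : e < (letterImage (word k)).length := by omega
    generalize word k = a at *
    generalize word (k + 1) = b at *
    have key : ∀ q ∈ pairs, ∀ e < (letterImage q.1).length, ∃ r ∈ pairs,
        (morphism [q.1, q.2])[e]? = some r.1 ∧ (morphism [q.1, q.2])[e + 1]? = some r.2 := by
      decide
    obtain ⟨⟨c, d⟩, hr, hc, hd⟩ := key _ hab e he
    rw [hocc.word_eq hc, add_assoc, hocc.word_eq hd]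
    exact hr

theorem morphism_iterate_pair (j k : ℕ) :
    OccursAt (morphism^[j] [word k, word (k + 1)]) (shift^[j] k) ∧
      shift^[j] k + (morphism^[j] [word k]).length = shift^[j] (k + 1) ∧
      shift^[j] k + (morphism^[j] [word k, word (k + 1)]).length = shift^[j] (k + 1 + 1) := by
  have h2 : OccursAt [word k, word (k + 1)] k := ⟨rfl, rfl, trivial⟩
  have h1 : OccursAt [word k] k := ⟨rfl, trivial⟩
  exact ⟨(h2.morphism_iterate j).1, (h1.morphism_iterate j).2, (h2.morphism_iterate j).2⟩

/-- If the second block of `ν^j(a) ν^j(b)` is always covered by the letter `0` shifted by small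
indices of this letter, then so is every large index. -/
theorem exists_zero_add_zero {j B : ℕ}
    (hcover : ∀ q ∈ pairs, ∀ r < (morphism^[j] [q.1, q.2]).length,
      (morphism^[j] [q.1]).length ≤ r → ∃ f < B, early 0 f ∧
        (morphism^[j] [q.1, q.2])[r - f]? = some 0 ∧ f ≤ r)
    {m : ℕ} (hm : num j ≤ m) : ∃ a b, word a = 0 ∧ word b = 0 ∧ a + b = m := by
  obtain ⟨k, h1, h2⟩ := exists_shift_iterate_le j m
  -- Since `m` is past the first block, a preceding block exists, and the summand of letter 0 may be
  -- sought in either of the two.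
  rcases k with _ | k
  · rw [num_eq_iterate] at hm
    rw [Nat.zero_add] at h2
    omega
  obtain ⟨hocc, hl, hl'⟩ := morphism_iterate_pair j k
  obtain ⟨f, -, hf, hr, hfr⟩ := hcover _ (pair_mem k) (m - shift^[j] k)
    (by simp only; omega) (by simp only; omega)
  exact ⟨_, f, hocc.word_eq hr, word_of_early hf, by omega⟩

theorem num_ten : num 10 = 60 := by decide +kernel

/-- Each index in the second block of `ν^10(a) ν^10(b)` is the sum of two indices of the letter
`0`, one of them less than `24`. -/
theorem exists_early_zero : ∀ q ∈ pairs, ∀ r < (morphism^[10] [q.1, q.2]).length,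
    (morphism^[10] [q.1]).length ≤ r → ∃ f < 24, early 0 f ∧
      (morphism^[10] [q.1, q.2])[r - f]? = some 0 ∧ f ≤ r := by
  decide +kernel

theorem P0_pair {n : ℕ} (hn : 17 ≤ n) : n ∈ P0 + P0 := by
  have add : ∀ a b, word a = 0 → word b = 0 → a + b + 2 ∈ P0 + P0 := fun a b ha hb => by
    refine ⟨a + 1, (mem_P0 _).2 ⟨by omega, ha⟩, b + 1, (mem_P0 _).2 ⟨by omega, hb⟩, ?_⟩
    simp only; omega
  rcases lt_or_ge n 62 with h | h
  · have : ∀ r < 45, ∃ a < 62, early 0 a ∧ a ≤ 15 + r ∧ early 0 (15 + r - a) := by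
      decide +kernel
    obtain ⟨a, -, ha, hab, hb⟩ := this (n - 17) (by omega)
    have := add a _ (word_of_early ha) (word_of_early hb)
    rwa [show a + (15 + (n - 17) - a) + 2 = n by omega] at this
  · obtain ⟨a, b, ha, hb, hab⟩ := exists_zero_add_zero (m := n - 2) exists_early_zero
      (by rw [num_ten]; omega)
    have := add a b ha hb
    rwa [show a + b + 2 = n by omega] at this

/-! ### Twofold sums of the letters 0 and 2 -/

/-- Every block ν(a) starts with 0 or 2. If n - 2 is not itself a block start, it is one more than
one; stepping back to the previous block start leaves 2 = `shift 1` or 3 = `shift 2`. -/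
theorem P02_pair {n : ℕ} (hn : 4 ≤ n) : n ∈ P02 + P02 := by
  have mem : ∀ a, shift a + 1 ∈ P02 := fun a => (mem_P02 _).2 ⟨by omega, by
    have := word_shift a
    rcases fin3_cases (word a) with h | h | h <;> rw [h] at this <;>
      simp [successors] at this <;> simp [this]⟩
  suffices ∃ a b, shift a + shift b + 2 = n by
    obtain ⟨a, b, h⟩ := this
    exact ⟨_, mem a, _, mem b, by simp only; omega⟩
  obtain ⟨k, e, h, he, -, -, hlt⟩ := exists_eq_shift_add (n - 2)
  have h1 : shift 1 = 2 := rfl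
  have h2 : shift 2 = 3 := by decide +kernel
  rcases fin3_cases (word k) with hk | hk | hk <;> rw [hk] at he <;> simp [successors] at he
  · rcases he with ⟨rfl, -⟩ | ⟨rfl, -⟩
    · exact ⟨0, k, by rw [shift]; omega⟩
    rcases k with _ | k
    -- Contradictory case: it would force n = 3, so the witnesses are arbitrary.
    · exact ⟨1, 0, by simp [shift] at h ⊢; omega⟩
    rcases fin3_cases (word k) with hk' | hk' | hk'
    · exact ⟨2, k, by rw [shift, hk', letterImage] at h; simp at h; omega⟩
    · exact ⟨1, k, by rw [shift, hk', letterImage] at h; simp at h; omega⟩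
    · exact ⟨1, k, by rw [shift, hk', letterImage] at h; simp at h; omega⟩
  · exact ⟨0, k, by rw [shift]; omega⟩
  · exact ⟨0, k, by rw [shift]; omega⟩

/-! ### The automaton of defects -/

/-- The defect of `x + y = n` at three consecutive scales, and the letters at `x` and `y`. -/
abbrev State := (ℤ × ℤ × ℤ) × Fin 3 × Fin 3

def state (x y n : ℕ) : State :=
  (((x : ℤ) + y - n, (shift x : ℤ) + shift y - shift n,
    (shift (shift x) : ℤ) + shift (shift y) - shift (shift n)), word x, word y)

/-- A numerical code for the states with small defects. -/
def encode (t : State) : ℕ :=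
  ((((t.1.1 + 8).toNat * 32 + (t.1.2.1 + 16).toNat) * 32 + (t.1.2.2 + 16).toNat) * 4 + t.2.1) * 4 +
    t.2.2

def decode (c : ℕ) : State :=
  (((c / 16384 : ℕ) - 8, (c / 512 % 32 : ℕ) - 16, (c / 16 % 32 : ℕ) - 16),
    Fin.ofNat 3 (c / 4 % 4), Fin.ofNat 3 (c % 4))

/-- The code of `t` is in `T`, and is faithful. -/
def HasState (T : List ℕ) (t : State) : Prop := T.any (Nat.beq (encode t)) ∧ decode (encode t) = t

instance (T : List ℕ) (t : State) : Decidable (HasState T t) := inferInstanceAs (Decidable (_ ∧ _))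

theorem HasState.exists_mem {T : List ℕ} {t : State} (h : HasState T t) : ∃ c ∈ T, decode c = t := by
  obtain ⟨h1, h2⟩ := h
  obtain ⟨c, hc, hct⟩ := List.any_eq_true.1 h1
  exact ⟨c, hc, by rw [← Nat.eq_of_beq_eq_true hct, h2]⟩

/-- All the pairs whose sum is within `K` of `n` have their state in `T`. -/
def Covers (K : ℤ) (n : ℕ) (T : List ℕ) : Prop :=
  ∀ x y : ℕ, -K ≤ (x : ℤ) + y - n → (x : ℤ) + y - n ≤ K → HasState T (state x y n)

/-- The state reached from `t` when the digits of `p`, `q` are appended to the summands and the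
digit `e` to the sum. -/
def advance (e : ℤ) (t : State) (p q : ℕ × Fin 3) : State :=
  ((t.1.2.1 + (p.1 + q.1 - e), t.1.2.2 + 2 * (p.1 + q.1 - e),
    t.1.2.2 + t.1.1 + 3 * (p.1 + q.1 - e)), p.2, q.2)

/-- Appending the digit `e` to the sum leads from states in `T` to states in `T'` only, and
no defect beyond `K` in absolute value, on either side, falls back to within `K`. -/
def Transfers (K e : ℤ) (T T' : List ℕ) : Prop :=
  ∀ c ∈ T, ((decode c).1.1 = K → K + e ≤ (decode c).1.2.1) ∧
    ((decode c).1.1 = -K → (decode c).1.2.1 ≤ e - K - 1) ∧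
    ∀ p ∈ successors (decode c).2.1, ∀ q ∈ successors (decode c).2.2,
      -K ≤ (advance e (decode c) p q).1.1 → (advance e (decode c) p q).1.1 ≤ K →
        HasState T' (advance e (decode c) p q)

instance (K e : ℤ) (T T' : List ℕ) : Decidable (Transfers K e T T') :=
  inferInstanceAs (Decidable (∀ c ∈ T, _))

/-- `m` has the representation of `n` followed by the digit `e`. -/
def Appends (n e m : ℕ) : Prop :=
  m = shift n + e ∧ shift m = shift (shift n) + 2 * e ∧
    shift (shift m) = shift (shift n) + n + 3 * e

theorem digit_le_one {a b : Fin 3} {e : ℕ} (h : (e, b) ∈ successors a) : e ≤ 1 := by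
  rcases fin3_cases a with rfl | rfl | rfl <;> simp [successors] at h <;> omega

/-- Once the stripped pair is known to have defect at most `K` in absolute value, its state lies in
`T` and one transition gives the claim. Pairs with larger defect are excluded by comparison, through
monotonicity of `shift`, with a pair of defect exactly `K` or `-K`. -/
theorem Covers.transfer {K : ℤ} {n e m : ℕ} {T T' : List ℕ} (hT : Covers K n T) (hK : 0 ≤ K)
    (hm : Appends n e m) (hE : Transfers K e T T') : Covers K m T' := by
  intro x' y' hlo hhi
  have get : ∀ u v : ℕ, -K ≤ (u : ℤ) + v - n → (u : ℤ) + v - n ≤ K →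
      ∃ c ∈ T, decode c = state u v n := fun u v h1 h2 => (hT u v h1 h2).exists_mem
  obtain ⟨x, a, hx, hax, hx1, hx2, hxlt⟩ := exists_eq_shift_add x'
  obtain ⟨y, b, hy, hby, hy1, hy2, hylt⟩ := exists_eq_shift_add y'
  obtain ⟨hm0, hm1, hm2⟩ := hm
  have ha := digit_le_one hax
  have hb := digit_le_one hby
  -- Lower the summands to defect `K`: strict monotonicity puts the new defect above `K`, whatever
  -- digits the summands receive.
  have upper : (x : ℤ) + y - n ≤ K := by
    by_contra hcon
    obtain ⟨u, v, huv, hux, hvy⟩ : ∃ u v : ℕ, (u : ℤ) + v - n = K ∧ u ≤ x ∧ v ≤ y := by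
      rcases le_total ((x : ℤ) - n) K with h | h
      · exact ⟨x, (K - x + n).toNat, by omega, le_rfl, by omega⟩
      · exact ⟨(K + n).toNat, 0, by omega, by omega, by omega⟩
    obtain ⟨c, hc, hcs⟩ := get u v (by omega) (by omega)
    have h1 := (hE c hc).1
    rw [hcs] at h1
    replace h1 := h1 huv
    have h2 : shift u + shift v < shift x + shift y := by
      rcases hux.lt_or_eq with h | h
      · exact add_lt_add_of_lt_of_le (shift_strictMono h) (shift_strictMono.monotone hvy)
      · exact add_lt_add_of_le_of_lt (shift_strictMono.monotone hux) (shift_strictMono (by omega))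
    simp only [state] at h1
    omega
  -- Raise `x` to `u` with defect `-K`. Then `x'` is below `shift u`, while `y'` exceeds `shift y`
  -- by at most 1, so the new defect is below `-K`.
  have lower : -K ≤ (x : ℤ) + y - n := by
    by_contra hcon
    obtain ⟨u, hu⟩ : ∃ u : ℕ, (u : ℤ) + y - n = -K := ⟨(n - K - y).toNat, by omega⟩
    obtain ⟨c, hc, hcs⟩ := get u y (by omega) (by omega)
    have h1 := (hE c hc).2.1
    rw [hcs] at h1
    replace h1 := h1 hu
    have h2 : shift (x + 1) ≤ shift u := shift_strictMono.monotone (by omega)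
    simp only [state] at h1
    omega
  obtain ⟨c, hc, hcs⟩ := get x y lower upper
  have h1 := (hE c hc).2.2
  rw [hcs] at h1
  have heq : state x' y' m = advance e (state x y n) (a, word x') (b, word y') := by
    refine Prod.ext (Prod.ext ?_ (Prod.ext ?_ ?_)) rfl <;> simp only [state, advance] <;> omega
  rw [heq]
  refine h1 _ hax _ hby ?_ ?_ <;> rw [← heq] <;> assumption

theorem appends_zero (n : ℕ) : Appends n 0 (shift n) := ⟨rfl, rfl, shift_shift_shift n⟩

theorem appends_one {n : ℕ} (hn : word n = 0) : Appends n 1 (shift n + 1) :=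
  ⟨rfl, shift_shift_add_one hn, shift_shift_shift_add_one hn⟩

/-- `m` has the representation of `n` followed by the digits `es`. -/
def AppendsAll : ℕ → List ℕ → ℕ → Prop
  | n, [], m => n = m
  | n, e :: es, m => ∃ k, Appends n e k ∧ AppendsAll k es m

/-- The codes of the states reached from `T` when the digit `e` is appended to the sum. -/
def nextCodes (K e : ℤ) (T : List ℕ) : List ℕ :=
  (T.flatMap fun c => (successors (decode c).2.1).flatMap fun p =>
    ((successors (decode c).2.2).map (advance e (decode c) p)).filterMap fun t =>
      if -K ≤ t.1.1 ∧ t.1.1 ≤ K then some (encode t) else none).foldr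
    (fun c l => if l.any (Nat.beq c) then l else c :: l) []

theorem covers_of_bounded {K n : ℕ} {T : List ℕ} (h : ∀ x < n + K + 1, ∀ y < n + K + 1,
    -(K : ℤ) ≤ (x : ℤ) + y - n → (x : ℤ) + y - n ≤ K → HasState T (state x y n)) :
    Covers K n T := fun x y h1 h2 => h x (by omega) y (by omega) h1 h2

/-! ### Values of digit strings -/

/-- The value of a digit string at the scale raised by `j`. -/
def valueAt (j : ℕ) : List ℕ → ℕ
  | [] => 0
  | e :: es => e * num (es.length + j) + valueAt j es

theorem value_eq_valueAt (L : List ℕ) : value L = valueAt 0 L := by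
  induction L with
  | nil => rfl
  | cons e es ih => rw [value, valueAt, ih, Nat.add_zero]

theorem valueAt_append_singleton (j : ℕ) (L : List ℕ) (e : ℕ) :
    valueAt j (L ++ [e]) = valueAt (j + 1) L + e * num j := by
  induction L with
  | nil => simp [valueAt]
  | cons a L ih =>
    rw [List.cons_append, valueAt, ih, valueAt, List.length_append, List.length_singleton,
      show L.length + 1 + j = L.length + (j + 1) by omega, add_assoc]

/-- The counterpart of `shift_shift_shift`: it expresses scale 3, which arises when a digit is
appended, by the scales already tracked. -/
theorem valueAt_three (L : List ℕ) : valueAt 3 L = valueAt 2 L + valueAt 0 L := by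
  induction L with
  | nil => rfl
  | cons a L ih =>
    simp only [valueAt, ih, num_add_three, Nat.add_zero]
    ring

/-- `L` represents `n` at all scales. -/
def Represents (L : List ℕ) (n : ℕ) : Prop :=
  valueAt 0 L = n ∧ valueAt 1 L = shift n ∧ valueAt 2 L = shift (shift n)

theorem Represents.append {L : List ℕ} {n e m : ℕ} (h : Represents L n) (hm : Appends n e m) :
    Represents (L ++ [e]) m := by
  obtain ⟨h0, h1, h2⟩ := h
  obtain ⟨m0, m1, m2⟩ := hm
  have n0 : num 0 = 1 := rfl
  have n1 : num 1 = 2 := rfl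
  have n2 : num 2 = 3 := rfl
  simp only [Represents, valueAt_append_singleton, valueAt_three, Nat.zero_add, Nat.reduceAdd,
    n0, n1, n2]
  omega

theorem Represents.appendAll {L es : List ℕ} {n m : ℕ} (h : Represents L n)
    (hm : AppendsAll n es m) : Represents (L ++ es) m := by
  induction es generalizing L n with
  | nil => cases hm; simpa using h
  | cons e es ih =>
    obtain ⟨k, hk, hkm⟩ := hm
    simpa using ih (h.append hk) hkm

theorem word_shift_shift_of_one {n : ℕ} (h : word n = 1) : word (shift (shift n)) = 0 := by
  have h2 : word (shift n) = 2 := by simpa [h, successors] using word_shift n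
  simpa [h2, successors] using word_shift (shift n)

/-! ### Excluded sums of two positions of the letter 1 -/

/-- Codes of the states of the sums with digits `(100)^i`. -/
@[irreducible] def statesA : List ℕ :=
    [53850, 53856, 53857, 53860, 54378, 54385, 54388, 54390, 54393, 54401, 54404, 70770, 70776,
    71298, 71304, 71306, 71312, 71313, 71316, 71845, 71861, 87696, 88224, 88226, 88232, 88758,
    88761, 88769, 88772, 88773, 105152, 105674, 105680, 105681, 105682, 105684, 105686, 105688,
    105689, 106229, 122594, 122600, 122602, 122608, 122609, 122612, 123137, 123140, 123141,
    123142, 123145, 139520, 139522, 139528, 140048, 140050, 140054, 140056, 140057, 140064,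
    140065, 140068, 140597, 156448, 156970, 156976, 156977, 156978, 156980, 156984, 157505,
    157508, 157510, 157513, 157521, 157524, 157525, 173890, 173896, 173904, 174418, 174424,
    174426, 174432, 174433, 174436, 174437, 174438, 174441, 174965, 174981, 190816, 191344,
    191346, 191350, 191352, 191353, 191354, 191360, 191361, 191364, 191878, 191881, 191889,
    191892, 191893, 208266, 208272, 208273, 208274, 208276, 208280, 208794, 208800, 208801,
    208802, 208804, 208806, 208808, 208809, 208817, 208820, 209349, 225186, 225192, 225200,
    225714, 225720, 225722, 225728, 225729, 225730, 225732, 225736, 226257, 226260, 226261,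
    226262, 226265, 226277]

/-- Codes of the states of the sums with digits `(100)^i 1`. -/
@[irreducible] def statesB : List ℕ :=
    [53306, 53312, 53313, 53316, 53834, 53841, 53844, 53846, 53849, 53857, 53860, 70226, 70232,
    70754, 70760, 70762, 70768, 70769, 70772, 71301, 71317, 87152, 87680, 87682, 87688, 88214,
    88217, 88225, 88228, 88229, 104608, 105130, 105136, 105137, 105138, 105140, 105142, 105144,
    105145, 105685, 122050, 122056, 122058, 122064, 122065, 122068, 122593, 122596, 122597,
    122598, 122601, 138976, 138978, 138984, 139504, 139506, 139510, 139512, 139513, 139520,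
    139521, 139524, 140053, 155904, 156426, 156432, 156433, 156434, 156436, 156440, 156961,
    156964, 156966, 156969, 156977, 156980, 156981, 173346, 173352, 173360, 173874, 173880,
    173882, 173888, 173889, 173892, 173893, 173894, 173897, 174421, 174437, 190272, 190800,
    190802, 190806, 190808, 190809, 190810, 190816, 190817, 190820, 191334, 191337, 191345,
    191348, 191349, 207722, 207728, 207729, 207730, 207732, 207736, 208250, 208256, 208257,
    208258, 208260, 208262, 208264, 208265, 208273, 208276, 208805, 224642, 224648, 224656,
    225170, 225176, 225178, 225184, 225185, 225186, 225188, 225192, 225713, 225716, 225717,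
    225718, 225721, 225733]

/-- Codes of the states of the sums with digits `(100)^i 10`. -/
@[irreducible] def statesC : List ℕ :=
    [53322, 53328, 53329, 53332, 53850, 53857, 53860, 53862, 53865, 53873, 53876, 70242, 70248,
    70770, 70776, 70778, 70784, 70785, 70788, 71317, 71333, 87168, 87696, 87698, 87704, 88230,
    88233, 88241, 88244, 88245, 104624, 105146, 105152, 105153, 105154, 105156, 105158, 105160,
    105161, 105701, 122066, 122072, 122074, 122080, 122081, 122084, 122609, 122612, 122613,
    122614, 122617, 138992, 138994, 139000, 139520, 139522, 139526, 139528, 139529, 139536,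
    139537, 139540, 140069, 155920, 156442, 156448, 156449, 156450, 156452, 156456, 156977,
    156980, 156982, 156985, 156993, 156996, 156997, 173362, 173368, 173376, 173890, 173896,
    173898, 173904, 173905, 173908, 173909, 173910, 173913, 174437, 174453, 190288, 190816,
    190818, 190822, 190824, 190825, 190826, 190832, 190833, 190836, 191350, 191353, 191361,
    191364, 191365, 207738, 207744, 207745, 207746, 207748, 207752, 208266, 208272, 208273,
    208274, 208276, 208278, 208280, 208281, 208289, 208292, 208821, 224658, 224664, 224672,
    225186, 225192, 225194, 225200, 225201, 225202, 225204, 225208, 225729, 225732, 225733,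
    225734, 225737, 225749]

/-- With the next two lemmas this closes a cycle: the digits 1, 0, 0 lead from `statesA` back to
`statesA`. -/
theorem transfers_A_B : Transfers 5 1 statesA statesB := by decide +kernel

theorem transfers_B_C : Transfers 5 0 statesB statesC := by decide +kernel

theorem transfers_C_A : Transfers 5 0 statesC statesA := by decide +kernel

theorem covers_zero_A : Covers 5 0 statesA := covers_of_bounded (K := 5) (by decide +kernel)

/-- Codes of the states of the sums with digits `(100)^i 0`. -/
@[irreducible] def statesA0 : List ℕ := nextCodes 5 0 statesA

/-- Codes of the states of the sums with digits `(100)^i 00`. -/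
@[irreducible] def statesA00 : List ℕ := nextCodes 5 0 statesA0

/-- Codes of the states of the sums with digits `(100)^i 000`. -/
@[irreducible] def statesA000 : List ℕ := nextCodes 5 0 statesA00

theorem transfers_A_A0 : Transfers 5 0 statesA statesA0 := by decide +kernel

theorem transfers_A0_A00 : Transfers 5 0 statesA0 statesA00 := by decide +kernel

theorem transfers_A00_A000 : Transfers 5 0 statesA00 statesA000 := by decide +kernel

/-- The defect is -2 because each index is one less than its position. -/
theorem avoids_A000 : ∀ c ∈ statesA000,
    ¬ ((decode c).1.1 = -2 ∧ (decode c).2.1 = 1 ∧ (decode c).2.2 = 1) := by decide +kernel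

theorem covers_one_zero_zero (i : ℕ) : ∃ n, word n = 0 ∧
    Represents (List.replicate i [1, 0, 0]).flatten n ∧ Covers 5 n statesA := by
  induction i with
  | zero => exact ⟨0, rfl, ⟨rfl, rfl, rfl⟩, covers_zero_A⟩
  | succ i ih =>
    obtain ⟨n, h0, hr, hc⟩ := ih
    have ha : AppendsAll n [1, 0, 0] _ :=
      ⟨_, appends_one h0, _, appends_zero _, _, appends_zero _, rfl⟩
    refine ⟨_, word_shift_shift_of_one (word_shift_add_one h0), ?_,
      ((hc.transfer (by norm_num) (appends_one h0) transfers_A_B).transfer (by norm_num)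
        (appends_zero _) transfers_B_C).transfer (by norm_num) (appends_zero _) transfers_C_A⟩
    rw [List.replicate_succ', List.flatten_concat]
    exact hr.appendAll ha

theorem not_mem_P1_add_P1 (i : ℕ) :
    value ((List.replicate i [1, 0, 0]).flatten ++ [1, 0, 0, 0, 0, 0]) ∉ P1 + P1 := by
  rintro ⟨x, hx, y, hy, hxy⟩
  obtain ⟨hx1, hx⟩ := (mem_P1 x).1 hx
  obtain ⟨hy1, hy⟩ := (mem_P1 y).1 hy
  -- Regroup (100)^i 100000 as (100)^(i+1) 000.
  obtain ⟨n, -, hr, hc⟩ := covers_one_zero_zero (i + 1)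
  have ha : AppendsAll n [0, 0, 0] _ :=
    ⟨_, appends_zero _, _, appends_zero _, _, appends_zero _, rfl⟩
  have hv := (hr.appendAll ha).1
  have hT := ((hc.transfer (by norm_num) (appends_zero _) transfers_A_A0).transfer (by norm_num)
    (appends_zero _) transfers_A0_A00).transfer (by norm_num) (appends_zero _) transfers_A00_A000
  rw [List.replicate_succ', List.flatten_concat, List.append_assoc, ← value_eq_valueAt] at hv
  have hxy : x + y = _ := hxy.trans hv
  obtain ⟨c, hc, hcs⟩ := (hT (x - 1) (y - 1) (by omega) (by omega)).exists_mem
  refine avoids_A000 c hc ?_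
  rw [hcs]
  exact ⟨by simp only [state]; omega, hx, hy⟩

/-! ### Excluded sums of two positions of the letter 2 -/

/-- Codes of the states of the sums with digits `1(00)^i`. -/
@[irreducible] def statesD : List ℕ :=
    [70240, 70768, 70770, 70776, 71302, 71305, 71313, 71316, 71317, 87696, 88218, 88224, 88225,
    88226, 88228, 88230, 88232, 88233, 88773, 105138, 105144, 105146, 105152, 105153, 105156,
    105681, 105684, 105685, 105686, 105689, 122064, 122066, 122072, 122592, 122594, 122598,
    122600, 122601, 122608, 122609, 122612, 123141, 138992, 139514, 139520, 139521, 139522,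
    139524, 139528, 140049, 140052, 140054, 140057, 140065, 140068, 140069, 156434, 156440,
    156448, 156962, 156968, 156970, 156976, 156977, 156980, 156981, 156982, 156985, 157509,
    157525, 173360, 173888, 173890, 173894, 173896, 173897, 173898, 173904, 173905, 173908,
    174422, 174425, 174433, 174436, 174437, 190810, 190816, 190817, 190818, 190820, 190824,
    191338, 191344, 191345, 191346, 191348, 191350, 191352, 191353, 191361, 191364, 191893,
    207730, 207736, 207744, 208258, 208264, 208266, 208272, 208273, 208274, 208276, 208280,
    208801, 208804, 208805, 208806, 208809, 208821]

/-- Codes of the states of the sums with digits `1(00)^i 1`. -/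
@[irreducible] def statesD1 : List ℕ := nextCodes 4 1 statesD

/-- `statesD` is closed under a single appended 0, so the parity of the number of zeros plays no
role in the covering. -/
theorem transfers_D_D : Transfers 4 0 statesD statesD := by decide +kernel

theorem transfers_D_D1 : Transfers 4 1 statesD statesD1 := by decide +kernel

theorem covers_one_D : Covers 4 1 statesD := covers_of_bounded (K := 4) (by decide +kernel)

theorem avoids_D1 : ∀ c ∈ statesD1,
    ¬ ((decode c).1.1 = -2 ∧ (decode c).2.1 = 2 ∧ (decode c).2.2 = 2) := by decide +kernel

theorem covers_one_replicate (i : ℕ) : ∃ n, word (shift (shift n)) = 0 ∧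
    Represents ([1] ++ (List.replicate i [0, 0]).flatten) n ∧ Covers 4 n statesD := by
  induction i with
  -- The letter at index 1 is 1, so two zeros must follow before a digit 1 can be appended; hence
  -- the invariant on `shift (shift n)`.
  | zero => exact ⟨1, word_shift_shift_of_one rfl, ⟨rfl, rfl, rfl⟩, covers_one_D⟩
  | succ i ih =>
    obtain ⟨n, h0, hr, hc⟩ := ih
    have ha : AppendsAll n [0, 0] _ := ⟨_, appends_zero _, _, appends_zero _, rfl⟩
    refine ⟨_, word_shift_of_zero (word_shift_of_zero h0), ?_,
      (hc.transfer (by norm_num) (appends_zero _) transfers_D_D).transfer (by norm_num)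
        (appends_zero _) transfers_D_D⟩
    rw [List.replicate_succ', List.flatten_concat, ← List.append_assoc]
    exact hr.appendAll ha

theorem not_mem_P2_add_P2 {i : ℕ} (hi : 1 ≤ i) :
    value ([1] ++ (List.replicate i [0, 0]).flatten ++ [1]) ∉ P2 + P2 := by
  rintro ⟨x, hx, y, hy, hxy⟩
  obtain ⟨hx1, hx⟩ := (mem_P2 x).1 hx
  obtain ⟨hy1, hy⟩ := (mem_P2 y).1 hy
  -- One block 00 is held back to reach a letter 0, which admits the final digit 1.
  obtain ⟨i, rfl⟩ := Nat.exists_eq_add_of_le' hi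
  obtain ⟨n, h0, hr, hc⟩ := covers_one_replicate i
  have ha : AppendsAll n [0, 0, 1] _ :=
    ⟨_, appends_zero _, _, appends_zero _, _, appends_one h0, rfl⟩
  have hv := (hr.appendAll ha).1
  have hT := ((hc.transfer (by norm_num) (appends_zero _) transfers_D_D).transfer (by norm_num)
    (appends_zero _) transfers_D_D).transfer (by norm_num) (appends_one h0) transfers_D_D1
  rw [← value_eq_valueAt] at hv
  have hxy : x + y = shift (shift (shift n)) + 1 := by
    refine Eq.trans ?_ hv
    rw [List.replicate_succ', List.flatten_concat] at hxy
    simpa using hxy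
  obtain ⟨c, hc, hcs⟩ := (hT (x - 1) (y - 1) (by omega) (by omega)).exists_mem
  refine avoids_D1 c hc ?_
  rw [hcs]
  exact ⟨by simp only [state]; omega, hx, hy⟩

end Narayana

theorem theorem22 :
    (∀ n : ℕ, 4 ≤ n → n ∈ Narayana.P02 + Narayana.P02) ∧
    (∀ n : ℕ, 17 ≤ n → n ∈ Narayana.P0 + Narayana.P0) ∧
    (∀ i : ℕ, Narayana.value ((List.replicate i [1, 0, 0]).flatten ++ [1, 0, 0, 0, 0, 0]) ∉
      Narayana.P1 + Narayana.P1) ∧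
    (∀ n : ℕ, 27 ≤ n → n ∈ Narayana.P1 + Narayana.P1 + Narayana.P1) ∧
    (∀ i : ℕ, 1 ≤ i → Narayana.value ([1] ++ (List.replicate i [0, 0]).flatten ++ [1]) ∉
      Narayana.P2 + Narayana.P2) ∧
    (∀ n : ℕ, 140 ≤ n → n ∈ Narayana.P2 + Narayana.P2 + Narayana.P2) := by
  exact ⟨fun _ => Narayana.P02_pair, fun _ => Narayana.P0_pair, Narayana.not_mem_P1_add_P1,
    fun _ => Narayana.P1_triple, fun _ => Narayana.not_mem_P2_add_P2, fun _ => Narayana.P2_triple⟩
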